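/- **Lemma 1.1 (Finitary Canonization).** For natural numbers define $\beth_0(x)=x$ and $\beth_{k+1}(x)=2^{\beth_k(x)}$. Let $n\ge 1$. A function $f$ defined on the $n$-element subsets of a set $A$ of natural numbers (we write $f(i_1,\dots,i_n)$ for $f(\{i_1,\dots,i_n\})$ when $i_1<\dots<i_n$) is *canonical* on $A'\subseteq A$ if there is $v\subseteq\{1,\dots,n\}$ such that for all $i_1<\dots<i_n$ from $A'$ and all $j_1<\dots<j_n$ from $A'$, $$f(i_1,\dots,i_n)=f(j_1,\dots,j_n)\iff i_\ell=j_\ell\text{ for all }\ell\in v.$$ Let $ER(n;m)$ be the least $N$ such that every function on the $n$-element subsets of $\{1,\dots,N\}$, with arbitrary values, is canonical on some $m$-element subset of $\{1,\dots,N\}$ (and $\infty$ if there is no such $N$). Then: 1. There is a computable function $n\mapsto c_n\in\mathbb N$ such that for every $n\ge1$ there is $M$ such that for all $m\ge M$ and all $m^\otimes>\beth_{n-1}\bigl(c_n\,m^{8(2n-1)}\bigr)$, every function on the $n$-element subsets of $\{1,\dots,m^\otimes\}$, with arbitrary values, is canonical on some $m$-element subset $A'$ of $\{1,\dots,m^\otimes\}$.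 2. For every $n\ge1$ there is a polynomial $p$ with coefficients in $\mathbb N$ such that $ER(n;m)\le\beth_{n-1}(p(m))$ for all $m$. 3. The number $n-1$ of exponentiations is best possible: for every $n\ge2$ and every polynomial $p$ with coefficients in $\mathbb N$, $ER(n;m)>\beth_{n-2}(p(m))$ for all large enough $m$. -/

import Mathlib

universe u

/-- The finite beth function: `finBeth 0 x = x` and `finBeth (n + 1) x = 2 ^ finBeth n x`. -/
def finBeth : ℕ → ℕ → ℕ
  | 0, x => x
  | n + 1, x => 2 ^ finBeth n x

/-- `f` (a function on finite sets, of which only the values at the `n`-element subsets of `A`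
matter) is canonical on `A`: there is a set `v` of positions such that for increasing `n`-tuples
`i`, `j` from `A`, the value of `f` at the set of entries of `i` equals its value at the set of
entries of `j` if and only if `i` and `j` agree at all positions in `v`. -/
def IsCanonicalOn {β : Type u} (n : ℕ) (f : Finset ℕ → β) (A : Finset ℕ) : Prop :=
  ∃ v : Finset (Fin n), ∀ i j : Fin n → ℕ, StrictMono i → StrictMono j →
    (∀ l, i l ∈ A) → (∀ l, j l ∈ A) →
    (f (Finset.univ.image i) = f (Finset.univ.image j) ↔ ∀ l ∈ v, i l = j l)

/-- Every function on the `n`-element subsets of `{1, …, N}`, with values in any set, is canonical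
on some `m`-element subset of `{1, …, N}`. -/
def Canonizes (N n m : ℕ) : Prop :=
  ∀ (β : Type u) (f : Finset ℕ → β),
    ∃ A : Finset ℕ, A ⊆ Finset.Icc 1 N ∧ A.card = m ∧ IsCanonicalOn n f A

/-- The Erdős–Rado number `ER(n; m)`: the least `N` such that every function on the `n`-element
subsets of `{1, …, N}` is canonical on some `m`-element subset (and `⊤` if there were no
such `N`). -/
noncomputable def ER (n m : ℕ) : ℕ∞ :=
  sInf {x : ℕ∞ | ∃ N : ℕ, x = (N : ℕ∞) ∧ Canonizes.{u} N n m}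

/-! Upper bounds: induction on the arity, carrying finitely many relations `U j b z` that are
downward closed in `z`. From a large reservoir, `exists_tree` extracts a set `X` with a top point
`w` such that for `y` in `X` and tuples `a`, `b` below `y`: whether `F (a, y) = F (b, y)` is
unchanged when `y` is replaced by `w`; `F (a, ·)` is constant from `y` on, or `F (a, y)` differs
from all values on tuples below `y`; `U j (a, ·)` holds for all pairs from `y` on, or `U j (a, y)`
fails at all later points. `exists_canonical` then canonizes `a ↦ F (a, w)`, making "not constant
from `y` on" and "not full from `y` on" homogeneous; these are again downward closed. The former
decides whether the last position belongs to `v`.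

The extraction is cheap because the reservoir `S` always maximizes `|S| * K ^ (number of settled
tests)`: any subset settling an open test has size at most `|S| / K`, so few points are harmful. A
stage thus costs one exponential of a polynomial. The lowest stage has boundedly many tests and is
polynomial, which leaves `n - 1` exponentials.

Lower bound: the Erdős–Hajnal stepping-up (`exists_stepUp_coloring`) gives colorings with boundedly
many colors and only small monochromatic sets. By `not_canonizes`, boundedly many colors force `v =
∅` on a large canonical set, which is then monochromatic. -/

open Finset

/-! ### Saturated reservoirs and the tree construction. -/

section Tree

variable {β ι : Type*} {n : ℕ}

/-- From `y` on, the value of `F` at `a` extended by one further element of `Y` is constant. -/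
def ConstFrom (F : (Fin (n + 1) → ℕ) → β) (Y : Finset ℕ) (a : Fin n → ℕ) (y : ℕ) : Prop :=
  ∀ y₁ ∈ Y, ∀ y₂ ∈ Y, y ≤ y₁ → y ≤ y₂ → F (Fin.snoc a y₁) = F (Fin.snoc a y₂)

/-- From `y` on, `V` holds between `a` extended by an element of `Y` and every larger element. -/
def FullFrom (V : (Fin (n + 1) → ℕ) → ℕ → Prop) (Y : Finset ℕ) (a : Fin n → ℕ) (y : ℕ) : Prop :=
  ∀ y₁ ∈ Y, ∀ y₂ ∈ Y, y ≤ y₁ → y₁ < y₂ → V (Fin.snoc a y₁) y₂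

/-- What the tree construction guarantees about an element `y` of the set `Y`. -/
structure IsGoodAt (F : (Fin (n + 1) → ℕ) → β) (U : ι → (Fin (n + 1) → ℕ) → ℕ → Prop)
    (Y : Finset ℕ) (y : ℕ) : Prop where
  iff_of_le : ∀ a b : Fin n → ℕ, (∀ l, a l ∈ Y ∧ a l < y) → (∀ l, b l ∈ Y ∧ b l < y) →
    ∀ y' ∈ Y, y ≤ y' →
      (F (Fin.snoc a y) = F (Fin.snoc b y) ↔ F (Fin.snoc a y') = F (Fin.snoc b y'))
  const_or_fresh : ∀ a : Fin n → ℕ, (∀ l, a l ∈ Y ∧ a l < y) →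
    ConstFrom F Y a y ∨ ∀ d : Fin (n + 1) → ℕ, (∀ l, d l ∈ Y ∧ d l < y) → F (Fin.snoc a y) ≠ F d
  full_or_empty : ∀ j, ∀ a : Fin n → ℕ, (∀ l, a l ∈ Y ∧ a l < y) →
    FullFrom (U j) Y a y ∨ ∀ z ∈ Y, y < z → ¬ U j (Fin.snoc a y) z

theorem IsGoodAt.mono {F : (Fin (n + 1) → ℕ) → β} {U : ι → (Fin (n + 1) → ℕ) → ℕ → Prop}
    {Y Y' : Finset ℕ} {y : ℕ} (h : IsGoodAt F U Y y) (hY : Y' ⊆ Y) : IsGoodAt F U Y' y where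
  iff_of_le a b ha hb y' hy' :=
    h.iff_of_le a b (fun l => ⟨hY (ha l).1, (ha l).2⟩) (fun l => ⟨hY (hb l).1, (hb l).2⟩) y' (hY hy')
  const_or_fresh a ha :=
    (h.const_or_fresh a fun l => ⟨hY (ha l).1, (ha l).2⟩).imp
      (fun h y₁ h₁ y₂ h₂ => h y₁ (hY h₁) y₂ (hY h₂))
      (fun h d hd => h d fun l => ⟨hY (hd l).1, (hd l).2⟩)
  full_or_empty j a ha :=
    (h.full_or_empty j a fun l => ⟨hY (ha l).1, (ha l).2⟩).imp
      (fun h y₁ h₁ y₂ h₂ => h y₁ (hY h₁) y₂ (hY h₂)) (fun h z hz => h z (hY hz))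

/-- The properties of a reservoir `S` that the construction tries to settle. -/
def Settled (F : (Fin (n + 1) → ℕ) → β) (U : ι → (Fin (n + 1) → ℕ) → ℕ → Prop) (S : Finset ℕ) :
    ((Fin n → ℕ) × (Fin n → ℕ)) ⊕ (Option ι × (Fin n → ℕ)) → Prop
  | .inl (a, b) => (∀ y ∈ S, F (Fin.snoc a y) = F (Fin.snoc b y)) ∨
      ∀ y ∈ S, F (Fin.snoc a y) ≠ F (Fin.snoc b y)
  | .inr (none, a) => ∀ y₁ ∈ S, ∀ y₂ ∈ S, F (Fin.snoc a y₁) = F (Fin.snoc a y₂)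
  | .inr (some j, a) => ∀ y₁ ∈ S, ∀ y₂ ∈ S, y₁ < y₂ → U j (Fin.snoc a y₁) y₂

theorem Settled.mono {F : (Fin (n + 1) → ℕ) → β} {U : ι → (Fin (n + 1) → ℕ) → ℕ → Prop}
    {S S' : Finset ℕ} (hS : S' ⊆ S) :
    ∀ {x : ((Fin n → ℕ) × (Fin n → ℕ)) ⊕ (Option ι × (Fin n → ℕ))},
      Settled F U S x → Settled F U S' x
  | .inl (_, _), h => h.imp (fun h y hy => h y (hS hy)) (fun h y hy => h y (hS hy))
  | .inr (none, _), h => fun y₁ h₁ y₂ h₂ => h y₁ (hS h₁) y₂ (hS h₂)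
  | .inr (some _, _), h => fun y₁ h₁ y₂ h₂ => h y₁ (hS h₁) y₂ (hS h₂)

variable [Fintype ι]

/-- The `n`-tuples with entries in `X`. -/
def tuples (n : ℕ) (X : Finset ℕ) : Finset (Fin n → ℕ) := Fintype.piFinset fun _ => X

theorem mem_tuples {X : Finset ℕ} {a : Fin n → ℕ} : a ∈ tuples n X ↔ ∀ l, a l ∈ X := by
  simp [tuples]

theorem card_tuples (X : Finset ℕ) : (tuples n X).card = X.card ^ n := by
  simp [tuples]

/-- The tests with parameters in `X`. -/
def tests (ι : Type*) [Fintype ι] (n : ℕ) (X : Finset ℕ) :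
    Finset (((Fin n → ℕ) × (Fin n → ℕ)) ⊕ (Option ι × (Fin n → ℕ))) :=
  (tuples n X ×ˢ tuples n X).disjSum (univ ×ˢ tuples n X)

theorem card_tests (X : Finset ℕ) :
    (tests ι n X).card = X.card ^ (2 * n) + (Fintype.card ι + 1) * X.card ^ n := by
  simp [tests, card_tuples, two_mul, pow_add]

theorem tests_mono {X X' : Finset ℕ} (h : X ⊆ X') : tests ι n X ⊆ tests ι n X' := by
  have h' : tuples n X ⊆ tuples n X' := fun a ha => mem_tuples.2 fun l => h (mem_tuples.1 ha l)
  exact disjSum_mono (product_subset_product h' h') (product_subset_product subset_rfl h')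

open Classical in
/-- The size of the reservoir, weighted by the number of settled tests. -/
noncomputable def weight (F : (Fin (n + 1) → ℕ) → β) (U : ι → (Fin (n + 1) → ℕ) → ℕ → Prop)
    (K : ℕ) (X S : Finset ℕ) : ℕ :=
  S.card * K ^ ((tests ι n X).filter (Settled F U S)).card

variable {F : (Fin (n + 1) → ℕ) → β} {U : ι → (Fin (n + 1) → ℕ) → ℕ → Prop} {K : ℕ}

theorem exists_saturated (F : (Fin (n + 1) → ℕ) → β) (U : ι → (Fin (n + 1) → ℕ) → ℕ → Prop)
    (K : ℕ) (X S : Finset ℕ) :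
    ∃ S' ⊆ S, weight F U K X S ≤ weight F U K X S' ∧
      ∀ R ⊆ S', weight F U K X R ≤ weight F U K X S' := by
  obtain ⟨S', hS', h⟩ := S.powerset.exists_max_image (weight F U K X) ⟨S, by simp⟩
  rw [mem_powerset] at hS'
  exact ⟨S', hS', h S (by simp), fun R hR => h R (by simpa using hR.trans hS')⟩

/-- Settling one more test multiplies the weight by at least `K`, so by maximality the size must
drop by that factor. -/
theorem card_mul_le_of_saturated (hK : 0 < K) {X S R : Finset ℕ}
    (hS : ∀ R ⊆ S, weight F U K X R ≤ weight F U K X S) (hR : R ⊆ S)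
    {x : ((Fin n → ℕ) × (Fin n → ℕ)) ⊕ (Option ι × (Fin n → ℕ))} (hx : x ∈ tests ι n X)
    (hxS : ¬ Settled F U S x) (hxR : Settled F U R x) : R.card * K ≤ S.card := by
  classical
  have h := hS R hR
  unfold weight at h
  have hlt : ((tests ι n X).filter (Settled F U S)).card + 1 ≤
      ((tests ι n X).filter (Settled F U R)).card := by
    refine card_lt_card ⟨fun z hz => ?_, fun hsub => ?_⟩
    · simp only [mem_filter] at hz ⊢
      exact ⟨hz.1, hz.2.mono hR⟩
    · have := hsub (mem_filter.2 ⟨hx, hxR⟩)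
      exact hxS (mem_filter.1 this).2
  have h2 := (Nat.mul_le_mul_left R.card (Nat.pow_le_pow_right hK hlt)).trans h
  rw [pow_succ, mul_comm (K ^ _) K, ← mul_assoc] at h2
  exact Nat.le_of_mul_le_mul_right h2 (by positivity)

theorem weight_le_weight (hK : 0 < K) {X X' S S' : Finset ℕ} (hX : X ⊆ X') (hS : S' ⊆ S)
    {p q : ℕ} (h : S.card * p ≤ S'.card * q) :
    weight F U K X S * p ≤ weight F U K X' S' * q := by
  classical
  unfold weight
  have : ((tests ι n X).filter (Settled F U S)).card ≤
      ((tests ι n X').filter (Settled F U S')).card := by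
    refine card_le_card fun z hz => ?_
    simp only [mem_filter] at hz ⊢
    exact ⟨tests_mono hX hz.1, hz.2.mono hS⟩
  calc _ = (S.card * p) * K ^ _ := by ring
    _ ≤ (S'.card * q) * K ^ _ := Nat.mul_le_mul h (Nat.pow_le_pow_right hK this)
    _ = _ := by ring

theorem weight_le (hK : 0 < K) (X S : Finset ℕ) :
    weight F U K X S ≤ S.card * K ^ (X.card ^ (2 * n) + (Fintype.card ι + 1) * X.card ^ n) := by
  classical
  unfold weight
  rw [← card_tests]
  exact Nat.mul_le_mul_left _ (Nat.pow_le_pow_right hK (card_filter_le _ _))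

end Tree

/-- In a finite set of naturals, some element is small in rank, outside a small exceptional set,
and related to few elements. -/
theorem exists_good_pick (S Z : Finset ℕ) (B : ℕ → ℕ → Prop)
    [∀ y, DecidablePred (B y)] (q : ℕ) (hq : q ≤ S.card)
    (hZ : 2 * Z.card < q) (hB : 2 * ∑ y ∈ S, (S.filter (B y)).card < q ^ 2) :
    ∃ y ∈ S, y ∉ Z ∧ (S.filter (· ≤ y)).card ≤ q ∧ (S.filter (B y)).card ≤ q := by
  set G := S.filter fun y => (S.filter (· ≤ y)).card ≤ q with hG
  set H := S.filter fun y => q < (S.filter (B y)).card with hH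
  have hGc : q ≤ G.card := by
    let e := S.orderEmbOfFin rfl
    have hinj : Function.Injective fun i : Fin q => e (Fin.castLE hq i) := fun i j h =>
      Fin.castLE_injective hq (e.injective h)
    have hsub : (univ : Finset (Fin q)).image (fun i => e (Fin.castLE hq i)) ⊆ G := by
      intro y hy
      simp only [mem_image, mem_univ, true_and] at hy
      obtain ⟨i, rfl⟩ := hy
      refine mem_filter.2 ⟨orderEmbOfFin_mem _ _ _, ?_⟩
      have : S.filter (· ≤ e (Fin.castLE hq i)) ⊆ (Iic (Fin.castLE hq i)).image e := by
        intro z hz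
        obtain ⟨hzS, hz⟩ := mem_filter.1 hz
        have : z ∈ Set.range e := by
          rw [Finset.range_orderEmbOfFin]; exact hzS
        obtain ⟨k, rfl⟩ := this
        exact mem_image.2 ⟨k, mem_Iic.2 (e.le_iff_le.1 hz), rfl⟩
      refine (card_le_card this).trans (card_image_le.trans ?_)
      rw [Fin.card_Iic]
      exact i.2
    calc q = ((univ : Finset (Fin q)).image fun i => e (Fin.castLE hq i)).card := by
          rw [card_image_of_injective _ hinj]; simp
      _ ≤ _ := card_le_card hsub
  have hHc : H.card * q ≤ ∑ y ∈ S, (S.filter (B y)).card :=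
    calc H.card * q = ∑ y ∈ H, q := by simp
      _ ≤ ∑ y ∈ H, (S.filter (B y)).card := sum_le_sum fun y hy => (mem_filter.1 hy).2.le
      _ ≤ _ := sum_le_sum_of_subset (filter_subset _ _)
  have hHq : 2 * H.card < q := by
    by_contra! h
    nlinarith
  have : (Z ∪ H).card < G.card := (card_union_le _ _).trans_lt (by omega)
  obtain ⟨y, hyG, hy⟩ := exists_mem_notMem_of_card_lt_card this
  simp only [mem_union, not_or] at hy
  have hyS := (mem_filter.1 hyG).1
  refine ⟨y, hyS, hy.1, (mem_filter.1 hyG).2, ?_⟩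
  by_contra! h
  exact hy.2 (mem_filter.2 ⟨hyS, h⟩)

section TreeStep

variable {β ι : Type*} {n : ℕ} [Fintype ι]
  {F : (Fin (n + 1) → ℕ) → β} {U : ι → (Fin (n + 1) → ℕ) → ℕ → Prop} {K : ℕ} {X S : Finset ℕ}

/-- Equality and inequality split `S` into two parts that each settle the test; both would have size
at most `|S| / K`, too little when `K > 2`. -/
theorem settled_pair_of_saturated (hK : 2 < K)
    (hS : ∀ R ⊆ S, weight F U K X R ≤ weight F U K X S) {a b : Fin n → ℕ}
    (ha : a ∈ tuples n X) (hb : b ∈ tuples n X) : Settled F U S (.inl (a, b)) := by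
  classical
  by_contra h
  have hx : (Sum.inl (a, b) : ((Fin n → ℕ) × (Fin n → ℕ)) ⊕ (Option ι × (Fin n → ℕ))) ∈
      tests ι n X := by simp [tests, ha, hb]
  have h1 := card_mul_le_of_saturated (by omega) hS
    (filter_subset (fun y => F (Fin.snoc a y) = F (Fin.snoc b y)) S) hx h
    (Or.inl fun y hy => (mem_filter.1 hy).2)
  have h2 := card_mul_le_of_saturated (by omega) hS
    (filter_subset (fun y => F (Fin.snoc a y) ≠ F (Fin.snoc b y)) S) hx h
    (Or.inr fun y hy => (mem_filter.1 hy).2)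
  have h3 := card_filter_add_card_filter_not (s := S) fun y => F (Fin.snoc a y) = F (Fin.snoc b y)
  have hpos : S.card = 0 := by
    by_contra h0
    have : S.card * K ≤ 2 * S.card := by
      simp only [ne_eq] at h2
      nth_rw 1 [← h3]
      rw [add_mul]
      omega
    have : 0 < S.card := by omega
    nlinarith
  rw [card_eq_zero] at hpos
  subst hpos
  exact h (Or.inl (by simp))

-- For fixed `a` and `d`, the colliding points all give `F` the value `F d`, so they would settle
-- the constancy test for `a`.
open Classical in
theorem card_collisions_mul_le (hK : 0 < K)
    (hS : ∀ R ⊆ S, weight F U K X R ≤ weight F U K X S) :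
    (S.filter fun z => ∃ a ∈ tuples n X, ¬ Settled F U S (.inr (none, a)) ∧
      ∃ d ∈ tuples (n + 1) X, F (Fin.snoc a z) = F d).card * K ≤
        X.card ^ (2 * n + 1) * S.card := by
  let T := tuples n X ×ˢ tuples (n + 1) X
  let C : (Fin n → ℕ) × (Fin (n + 1) → ℕ) → Finset ℕ := fun p =>
    S.filter fun z => ¬ Settled F U S (.inr (none, p.1)) ∧ F (Fin.snoc p.1 z) = F p.2
  have hsub : (S.filter fun z => ∃ a ∈ tuples n X, ¬ Settled F U S (.inr (none, a)) ∧
      ∃ d ∈ tuples (n + 1) X, F (Fin.snoc a z) = F d) ⊆ T.biUnion C := by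
    intro z hz
    obtain ⟨hzS, a, ha, hs, d, hd, h⟩ := mem_filter.1 hz
    exact mem_biUnion.2 ⟨(a, d), mem_product.2 ⟨ha, hd⟩, mem_filter.2 ⟨hzS, hs, h⟩⟩
  calc _ ≤ (∑ p ∈ T, (C p).card) * K :=
        Nat.mul_le_mul_right _ ((card_le_card hsub).trans card_biUnion_le)
    _ = ∑ p ∈ T, (C p).card * K := sum_mul _ _ _
    _ ≤ ∑ p ∈ T, S.card := sum_le_sum fun p hp => ?_
    _ = _ := by
      simp only [T, sum_const, card_product, card_tuples, smul_eq_mul]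
      ring
  by_cases hs : Settled F U S (.inr (none, p.1))
  · simp [C, hs]
  · refine card_mul_le_of_saturated hK hS (filter_subset _ _) (x := .inr (none, p.1))
      (by simp [tests, (mem_product.1 hp).1]) hs fun y₁ h₁ y₂ h₂ => ?_
    rw [(mem_filter.1 h₁).2.2, (mem_filter.1 h₂).2.2]

-- Downward closure is essential here: if `y₁ < y₂ < z` and `U j (a, y₁) z`, then `U j (a, y₁) y₂`.
-- So the points `y` covering a fixed `z` would settle the test.
open Classical in
theorem card_covering_mul_le (hK : 0 < K)
    (hU : ∀ j b z z', z' ≤ z → U j b z → U j b z')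
    (hS : ∀ R ⊆ S, weight F U K X R ≤ weight F U K X S) (z : ℕ) :
    (S.filter fun y => y < z ∧ ∃ j, ∃ a ∈ tuples n X, ¬ Settled F U S (.inr (some j, a)) ∧
      U j (Fin.snoc a y) z).card * K ≤ Fintype.card ι * X.card ^ n * S.card := by
  let T := (univ : Finset ι) ×ˢ tuples n X
  let C : ι × (Fin n → ℕ) → Finset ℕ := fun p =>
    S.filter fun y => y < z ∧ ¬ Settled F U S (.inr (some p.1, p.2)) ∧ U p.1 (Fin.snoc p.2 y) z
  have hsub : (S.filter fun y => y < z ∧ ∃ j, ∃ a ∈ tuples n X,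
      ¬ Settled F U S (.inr (some j, a)) ∧ U j (Fin.snoc a y) z) ⊆ T.biUnion C := by
    intro y hy
    obtain ⟨hyS, hyz, j, a, ha, hs, h⟩ := mem_filter.1 hy
    exact mem_biUnion.2 ⟨(j, a), mem_product.2 ⟨mem_univ _, ha⟩, mem_filter.2 ⟨hyS, hyz, hs, h⟩⟩
  calc _ ≤ (∑ p ∈ T, (C p).card) * K :=
        Nat.mul_le_mul_right _ ((card_le_card hsub).trans card_biUnion_le)
    _ = ∑ p ∈ T, (C p).card * K := sum_mul _ _ _
    _ ≤ ∑ p ∈ T, S.card := sum_le_sum fun p hp => ?_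
    _ = _ := by simp only [T, sum_const, card_product, card_tuples, smul_eq_mul, card_univ]
  by_cases hs : Settled F U S (.inr (some p.1, p.2))
  · simp [C, hs]
  · refine card_mul_le_of_saturated hK hS (filter_subset _ _) (x := .inr (some p.1, p.2))
      (by simp [tests, (mem_product.1 hp).2]) hs fun y₁ h₁ y₂ h₂ _ => ?_
    exact hU _ _ _ _ (mem_filter.1 h₂).2.1.le (mem_filter.1 h₁).2.2.2

theorem exists_next {L : ℕ} (hK : 1000 * (Fintype.card ι + 1) * L ^ (2 * n + 2) ≤ K)
    (hU : ∀ j b z z', z' ≤ z → U j b z → U j b z')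
    (hX : X.card < L) (hS : ∀ R ⊆ S, weight F U K X R ≤ weight F U K X S)
    (hSL : 8 * L ≤ S.card) (hlt : ∀ x ∈ X, ∀ s ∈ S, x < s) :
    ∃ y ∈ S, ∃ S' ⊆ S, (∀ z ∈ S', y < z) ∧ S.card * (2 * L - 1) ≤ S'.card * (2 * L) ∧
      IsGoodAt F U (insert y (X ∪ S')) y := by
  classical
  have hL : 0 < L := by omega
  have hLp : ∀ k, 0 < L ^ k := fun k => by positivity
  have hK1000 : 1000 ≤ K := le_trans (by nlinarith [hLp (2 * n + 2)]) hK
  set s := Fintype.card ι with hs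
  set Z := S.filter fun z => ∃ a ∈ tuples n X, ¬ Settled F U S (.inr (none, a)) ∧
      ∃ d ∈ tuples (n + 1) X, F (Fin.snoc a z) = F d with hZdef
  set B : ℕ → ℕ → Prop := fun y z => y < z ∧ ∃ j, ∃ a ∈ tuples n X,
    ¬ Settled F U S (.inr (some j, a)) ∧ U j (Fin.snoc a y) z with hBdef
  -- Dropping the points up to `y` and those related to `y` loses at most `2 * q`, within the
  -- allowed `|S| / (2 * L)`.
  set q := S.card / (8 * L) with hq
  have hq1 : 1 ≤ q := (Nat.one_le_div_iff (by omega)).2 hSL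
  have hq2 : 8 * L * q ≤ S.card := Nat.mul_div_le _ _
  have hq3 : S.card ≤ 16 * L * q := by
    have : S.card < 8 * L * (q + 1) := Nat.lt_mul_div_succ _ (by omega)
    nlinarith
  have hZ : 2 * Z.card < q := by
    have h1 : Z.card * K ≤ X.card ^ (2 * n + 1) * S.card := card_collisions_mul_le (by omega) hS
    have h2 : X.card ^ (2 * n + 1) * S.card ≤ L ^ (2 * n + 1) * (16 * L * q) :=
      Nat.mul_le_mul (Nat.pow_le_pow_left hX.le _) hq3
    have h3 : Z.card * (1000 * L ^ (2 * n + 2)) ≤ Z.card * K := by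
      refine Nat.mul_le_mul_left _ (le_trans ?_ hK)
      nlinarith [hLp (2 * n + 2)]
    have h4 : L ^ (2 * n + 2) * (Z.card * 1000) ≤ L ^ (2 * n + 2) * (16 * q) := by
      have : L ^ (2 * n + 2) = L ^ (2 * n + 1) * L := pow_succ _ _
      nlinarith
    have := Nat.le_of_mul_le_mul_left h4 (hLp _)
    omega
  have hB : 2 * ∑ y ∈ S, (S.filter (B y)).card < q ^ 2 := by
    -- Double counting: few `y` below each `z` means few `z` above an average `y`.
    have h0 : ∑ y ∈ S, (S.filter (B y)).card = ∑ z ∈ S, (S.filter fun y => B y z).card :=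
      sum_card_bipartiteAbove_eq_sum_card_bipartiteBelow _
    set E := ∑ y ∈ S, (S.filter (B y)).card
    have h1 : E * K ≤ S.card * (s * X.card ^ n * S.card) := by
      rw [h0, sum_mul]
      refine (sum_le_sum fun z _ => card_covering_mul_le (by omega) hU hS z).trans ?_
      simp [hs]
    have h2 : S.card * (s * X.card ^ n * S.card) ≤ (16 * L * q) * (s * L ^ n * (16 * L * q)) := by
      gcongr
    have h3 : E * (1000 * (s + 1) * L ^ (n + 2)) ≤ E * K := by
      refine Nat.mul_le_mul_left _ (le_trans ?_ hK)
      gcongr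
      all_goals omega
    have h4 : ((s + 1) * L ^ (n + 2)) * (E * 1000) ≤ ((s + 1) * L ^ (n + 2)) * (256 * q ^ 2) :=
      calc _ = E * (1000 * (s + 1) * L ^ (n + 2)) := by ring
        _ ≤ (16 * L * q) * (s * L ^ n * (16 * L * q)) := (h3.trans h1).trans h2
        _ = s * L ^ (n + 2) * (256 * q ^ 2) := by ring
        _ ≤ _ := by gcongr; omega
    have := Nat.le_of_mul_le_mul_left h4 (by positivity)
    have : 1 ≤ q ^ 2 := Nat.one_le_pow _ _ hq1
    omega
  have hqS : q ≤ S.card := Nat.div_le_self _ _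
  obtain ⟨y, hyS, hyZ, hyr, hyB⟩ := exists_good_pick S Z B q hqS hZ hB
  have hS'sub : S.filter (fun z => y < z ∧ ¬ B y z) ⊆ S := filter_subset _ _
  refine ⟨y, hyS, S.filter (fun z => y < z ∧ ¬ B y z), hS'sub,
    fun z hz => (mem_filter.1 hz).2.1, ?_, ?_⟩
  · have hc : S.card ≤ (S.filter (fun z => y < z ∧ ¬ B y z)).card + 2 * q := by
      have : S ⊆ S.filter (fun z => y < z ∧ ¬ B y z) ∪ (S.filter (· ≤ y) ∪ S.filter (B y)) := by
        intro z hz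
        simp only [mem_union, mem_filter, hz, true_and]
        by_cases h1 : z ≤ y <;> by_cases h2 : B y z <;> simp [h1, h2]; omega
      have h1 := (card_le_card this).trans (card_union_le _ _)
      have h2 := card_union_le (S.filter (· ≤ y)) (S.filter (B y))
      omega
    obtain ⟨M, hM⟩ : ∃ M, 2 * L = M + 1 := ⟨2 * L - 1, by omega⟩
    have h5 : S.card * (2 * L) ≤ ((S.filter (fun z => y < z ∧ ¬ B y z)).card + 2 * q) * (2 * L) :=
      Nat.mul_le_mul_right _ hc
    rw [hM, Nat.add_sub_cancel]
    rw [hM] at h5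
    nlinarith
  · have hYlt : ∀ x ∈ insert y (X ∪ S.filter fun z => y < z ∧ ¬ B y z), x < y → x ∈ X := by
      intro x hx hxy
      simp only [mem_insert, mem_union, mem_filter] at hx
      rcases hx with rfl | hx | hx
      · omega
      · exact hx
      · omega
    have hYge : ∀ x ∈ insert y (X ∪ S.filter fun z => y < z ∧ ¬ B y z), y ≤ x → x ∈ S := by
      intro x hx hxy
      simp only [mem_insert, mem_union, mem_filter] at hx
      rcases hx with rfl | hx | hx
      · exact hyS
      · exact absurd (hlt x hx y hyS) (by omega)
      · exact hx.1
    have htup : ∀ {k : ℕ} (a : Fin k → ℕ),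
        (∀ l, a l ∈ insert y (X ∪ S.filter fun z => y < z ∧ ¬ B y z) ∧ a l < y) →
        a ∈ tuples k X := fun a ha => mem_tuples.2 fun l => hYlt _ (ha l).1 (ha l).2
    refine ⟨fun a b ha hb y' hy' hyy' => ?_, fun a ha => ?_, fun j a ha => ?_⟩
    · rcases settled_pair_of_saturated (by omega) hS (htup a ha) (htup b hb) with h | h
      · exact iff_of_true (h y hyS) (h y' (hYge y' hy' hyy'))
      · exact iff_of_false (h y hyS) (h y' (hYge y' hy' hyy'))
    · by_cases h : Settled F U S (.inr (none, a))
      · exact Or.inl fun y₁ h₁ y₂ h₂ h₁' h₂' => h _ (hYge _ h₁ h₁') _ (hYge _ h₂ h₂')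
      · refine Or.inr fun d hd hF => hyZ ?_
        exact mem_filter.2 ⟨hyS, a, htup a ha, h, d, htup d hd, hF⟩
    · by_cases h : Settled F U S (.inr (some j, a))
      · exact Or.inl fun y₁ h₁ y₂ h₂ h₁' h₁₂ =>
          h _ (hYge _ h₁ h₁') _ (hYge _ h₂ (h₁'.trans h₁₂.le)) h₁₂
      · refine Or.inr fun z hz hyz hUz => ?_
        simp only [mem_insert, mem_union, mem_filter] at hz
        rcases hz with rfl | hz | hz
        · omega
        · exact absurd (hlt z hz y hyS) (by omega)
        · exact hz.2.2 ⟨hyz, j, a, htup a ha, h, hUz⟩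

end TreeStep

section Tree

variable {β ι : Type*} {n : ℕ} [Fintype ι]

/-- How large a reservoir has to be for the tree construction to yield `L` elements. -/
def treeBound (n s L : ℕ) : ℕ :=
  16 * L * (1000 * (s + 1) * L ^ (2 * n + 2)) ^ (L ^ (2 * n) + (s + 1) * L ^ n)

theorem exists_tree (F : (Fin (n + 1) → ℕ) → β) (U : ι → (Fin (n + 1) → ℕ) → ℕ → Prop)
    (hU : ∀ j b z z', z' ≤ z → U j b z → U j b z') {L : ℕ} (hL : 0 < L) (S₀ : Finset ℕ)
    (hS₀ : treeBound n (Fintype.card ι) L ≤ S₀.card) :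
    ∃ X ⊆ S₀, X.card = L ∧ ∃ w, (∀ x ∈ X, x < w) ∧ ∀ y ∈ X, IsGoodAt F U (insert w X) y := by
  classical
  obtain ⟨K, hK⟩ : ∃ K, 1000 * (Fintype.card ι + 1) * L ^ (2 * n + 2) = K := ⟨_, rfl⟩
  have hK0 : 0 < K := hK ▸ by positivity
  rw [treeBound, hK] at hS₀
  -- At least half of the initial size survives as weight, and the tests account for a bounded power
  -- of `K`; the rest must come from `|S|`.
  have hlarge : ∀ X S : Finset ℕ, X.card ≤ L → ∀ k ≤ L,
      S₀.card * (2 * L - k) ≤ weight F U K X S * (2 * L) → 8 * L ≤ S.card := by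
    intro X S hX k hk h
    have h1 := weight_le (F := F) (U := U) hK0 X S
    have h2 : S.card * K ^ (X.card ^ (2 * n) + (Fintype.card ι + 1) * X.card ^ n) ≤
        S.card * K ^ (L ^ (2 * n) + (Fintype.card ι + 1) * L ^ n) := by
      gcongr
    have h3 : S₀.card * L ≤ S₀.card * (2 * L - k) := Nat.mul_le_mul_left _ (by omega)
    have h4 : (16 * L * K ^ (L ^ (2 * n) + (Fintype.card ι + 1) * L ^ n)) * L ≤ S₀.card * L :=
      Nat.mul_le_mul_right _ hS₀
    have h5 : (8 * L) * (K ^ (L ^ (2 * n) + (Fintype.card ι + 1) * L ^ n) * (2 * L)) ≤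
        S.card * (K ^ (L ^ (2 * n) + (Fintype.card ι + 1) * L ^ n) * (2 * L)) := by
      have := Nat.mul_le_mul_right (2 * L) (h1.trans h2)
      calc _ = (16 * L * K ^ (L ^ (2 * n) + (Fintype.card ι + 1) * L ^ n)) * L := by ring
        _ ≤ _ := h4.trans (h3.trans (h.trans this))
        _ = _ := by ring
    exact Nat.le_of_mul_le_mul_right h5 (by positivity)
  have key : ∀ k ≤ L, ∃ X ⊆ S₀, X.card = k ∧ ∃ S ⊆ S₀, (∀ x ∈ X, ∀ s ∈ S, x < s) ∧
      (∀ R ⊆ S, weight F U K X R ≤ weight F U K X S) ∧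
      S₀.card * (2 * L - k) ≤ weight F U K X S * (2 * L) ∧
      ∀ y ∈ X, IsGoodAt F U (X ∪ S) y := by
    intro k
    induction k with
    | zero =>
      intro _
      obtain ⟨S, hS, hw, hsat⟩ := exists_saturated F U K ∅ S₀
      refine ⟨∅, by simp, rfl, S, hS, by simp, hsat, ?_, by simp⟩
      refine Nat.mul_le_mul_right _ (le_trans ?_ hw)
      exact Nat.le_mul_of_pos_right _ (by positivity)
    | succ k ih =>
      intro hk
      obtain ⟨X, hXS, hX, S, hSS, hlt, hsat, hw, hgood⟩ := ih (by omega)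
      obtain ⟨y, hy, S', hS', hyS', hc, hygood⟩ := exists_next hK.le hU (by omega) hsat
        (hlarge X S (by omega) k (by omega) hw) hlt
      obtain ⟨S'', hS'', hw'', hsat''⟩ := exists_saturated F U K (insert y X) S'
      have hyX : y ∉ X := fun h => lt_irrefl _ (hlt y h y hy)
      refine ⟨insert y X, insert_subset (hSS hy) hXS, by rw [card_insert_of_notMem hyX, hX],
        S'', (hS''.trans hS').trans hSS, ?_, hsat'', ?_, ?_⟩
      · intro x hx z hz
        rcases mem_insert.1 hx with rfl | hx
        · exact hyS' z (hS'' hz)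
        · exact hlt x hx z (hS' (hS'' hz))
      · have h1 := weight_le_weight (F := F) (U := U) hK0 (subset_insert y X) hS' hc
        have h2 := Nat.mul_le_mul_right (2 * L) hw''
        obtain ⟨M, hM⟩ : ∃ M, 2 * L = M + k + 1 := ⟨2 * L - k - 1, by omega⟩
        have e1 : 2 * L - k = M + 1 := by omega
        have e2 : 2 * L - (k + 1) = M := by omega
        have e3 : 2 * L - 1 = M + k := by omega
        rw [e3] at h1
        rw [e1] at hw
        rw [e2]
        have h3 : S₀.card * (M + 1) * (M + k) ≤ weight F U K (insert y X) S'' * (2 * L) * (2 * L) :=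
          calc S₀.card * (M + 1) * (M + k) ≤ weight F U K X S * (2 * L) * (M + k) :=
                Nat.mul_le_mul_right _ hw
            _ = weight F U K X S * (M + k) * (2 * L) := by ring
            _ ≤ _ := Nat.mul_le_mul_right _ (h1.trans h2)
        -- Bernoulli: `(1 - k / 2L) (1 - 1 / 2L) ≥ 1 - (k + 1) / 2L`.
        refine Nat.le_of_mul_le_mul_right (le_trans ?_ h3) (by omega : 0 < 2 * L)
        rw [hM, mul_assoc, mul_assoc]
        exact Nat.mul_le_mul_left _ (by nlinarith)
      · intro x hx
        rcases mem_insert.1 hx with rfl | hx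
        · exact hygood.mono (by rw [insert_union]; gcongr)
        · refine (hgood x hx).mono fun z hz => ?_
          simp only [mem_union, mem_insert] at hz ⊢
          rcases hz with (rfl | hz) | hz
          · exact Or.inr hy
          · exact Or.inl hz
          · exact Or.inr (hS' (hS'' hz))
  obtain ⟨X, hXS, hX, S, hSS, hlt, -, hw, hgood⟩ := key L le_rfl
  have hS8 := hlarge X S hX.le L le_rfl hw
  obtain ⟨w, hwS⟩ : S.Nonempty := card_pos.1 (by omega)
  refine ⟨X, hXS, hX, w, fun x hx => hlt x hx w hwS, fun y hy => (hgood y hy).mono ?_⟩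
  exact insert_subset (mem_union_right _ hwS) subset_union_left

end Tree

/-! ### Induction on the arity. -/

section Canonization

variable {n : ℕ}

/-- Either all or none of the pairs of an `n`-tuple from `X` and a larger element of `X` satisfy
`U`. -/
def HomogeneousOn (U : (Fin n → ℕ) → ℕ → Prop) (X : Finset ℕ) : Prop :=
  (∀ b, StrictMono b → (∀ l, b l ∈ X) → ∀ z ∈ X, (∀ l, b l < z) → U b z) ∨
    ∀ b, StrictMono b → (∀ l, b l ∈ X) → ∀ z ∈ X, (∀ l, b l < z) → ¬ U b z

theorem strictMono_init {i : Fin (n + 1) → ℕ} (hi : StrictMono i) :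
    StrictMono (Fin.init i : Fin n → ℕ) := fun _ _ h => hi (by simpa using h)

theorem init_lt_last {i : Fin (n + 1) → ℕ} (hi : StrictMono i) (l : Fin n) :
    (Fin.init i : Fin n → ℕ) l < i (Fin.last n) := hi (Fin.castSucc_lt_last l)

/-- A size from which on an `n`-ary function can be canonized on an `m`-element set that is
homogeneous for `s` given relations at the same time. -/
def canonBound : ℕ → ℕ → ℕ → ℕ
  | 0, s, m => 2 ^ s * m
  | n + 1, s, m => treeBound n s (canonBound n (s + 1) m)

theorem canonBound_pos {m : ℕ} (hm : 0 < m) : ∀ n s, 0 < canonBound n s m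
  | 0, s => by simp [canonBound, hm]
  | n + 1, s => by
    have := canonBound_pos hm n (s + 1)
    simp only [canonBound, treeBound]
    positivity

theorem exists_canonical {m : ℕ} (hm : 0 < m) (n : ℕ) :
    ∀ {β ι : Type*} [Fintype ι] (F : (Fin n → ℕ) → β) (U : ι → (Fin n → ℕ) → ℕ → Prop)
      (_ : ∀ j b z z', z' ≤ z → U j b z → U j b z') (S : Finset ℕ)
      (_ : canonBound n (Fintype.card ι) m ≤ S.card),
      ∃ A ⊆ S, A.card = m ∧
        (∃ v : Finset (Fin n), ∀ i j, StrictMono i → StrictMono j → (∀ l, i l ∈ A) →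
          (∀ l, j l ∈ A) → (F i = F j ↔ ∀ l ∈ v, i l = j l)) ∧
        ∀ j, HomogeneousOn (U j) A := by
  induction n with
  | zero =>
    intro β ι _ F U _ S hS
    classical
    -- There is only the empty tuple, so pigeonhole on the truth vectors of the `U j` at `z`
    -- suffices.
    obtain ⟨p, -, hp⟩ := exists_le_card_fiber_of_mul_le_card_of_maps_to
      (s := S) (t := (univ : Finset (ι → Bool))) (n := m)
      (f := fun z j => decide (U j Fin.elim0 z)) (by simp) univ_nonempty
      (by simpa [canonBound] using hS)
    obtain ⟨A, hA, hAm⟩ := exists_subset_card_eq hp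
    have hAp : ∀ z ∈ A, ∀ j, decide (U j Fin.elim0 z) = p j := fun z hz j =>
      congrFun (mem_filter.1 (hA hz)).2 j
    refine ⟨A, hA.trans (filter_subset _ _), hAm, ⟨∅, fun i j _ _ _ _ => ?_⟩, fun j => ?_⟩
    · simp [Subsingleton.elim i j]
    · cases hpj : p j
      · refine Or.inr fun b _ _ z hz _ => ?_
        have := hAp z hz j
        rw [Subsingleton.elim b Fin.elim0]
        simpa [hpj] using this
      · refine Or.inl fun b _ _ z hz _ => ?_
        have := hAp z hz j
        rw [Subsingleton.elim b Fin.elim0]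
        simpa [hpj] using this
  | succ n ih =>
    intro β ι _ F U hU S hS
    classical
    obtain ⟨X, hXS, hX, w, hw, hgood⟩ :=
      exists_tree F U hU (canonBound_pos hm n (Fintype.card ι + 1)) S hS
    -- Constancy and fullness persist as the starting point grows; their negations are therefore
    -- downward closed.
    let U' : Option ι → (Fin n → ℕ) → ℕ → Prop := fun o a z =>
      match o with
      | none => ¬ ConstFrom F (insert w X) a z
      | some j => ¬ FullFrom (U j) (insert w X) a z
    have hU' : ∀ o b z z', z' ≤ z → U' o b z → U' o b z' := by
      rintro (_ | j) b z z' hz h h'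
      · exact h fun y₁ h₁ y₂ h₂ h₁' h₂' => h' y₁ h₁ y₂ h₂ (hz.trans h₁') (hz.trans h₂')
      · exact h fun y₁ h₁ y₂ h₂ h₁' h₁₂ => h' y₁ h₁ y₂ h₂ (hz.trans h₁') h₁₂
    obtain ⟨A, hAX, hAm, ⟨v, hv⟩, hhom⟩ :=
      ih (fun a => F (Fin.snoc a w)) U' hU' X (by rw [hX, Fintype.card_option])
    have hAY : ∀ {x}, x ∈ A → x ∈ insert w X := fun hx => mem_insert_of_mem (hAX hx)
    have hpre : ∀ {a : Fin n → ℕ} {y : ℕ}, (∀ l, a l ∈ A) → (∀ l, a l < y) →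
        ∀ l, a l ∈ insert w X ∧ a l < y := fun ha hay l => ⟨hAY (ha l), hay l⟩
    refine ⟨A, hAX.trans hXS, hAm, ?_, fun j => ?_⟩
    · rcases hhom none with h | h
      -- Never constant, hence always fresh: tuples with different last entries get different
      -- values.
      · refine ⟨v.map Fin.castSuccEmb ∪ {Fin.last n}, fun i j hi hj hiA hjA => ?_⟩
        have hne : ∀ {i j : Fin (n + 1) → ℕ}, StrictMono i → StrictMono j → (∀ l, i l ∈ A) →
            (∀ l, j l ∈ A) → j (Fin.last n) < i (Fin.last n) → F i ≠ F j := by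
          intro i j hi hj hiA hjA hlt
          have hpi := hpre (fun l => hiA (Fin.castSucc l)) (init_lt_last hi)
          rcases (hgood _ (hAX (hiA (Fin.last n)))).const_or_fresh (Fin.init i) hpi with h' | h'
          · exact absurd h' (h (Fin.init i) (strictMono_init hi) (fun l => hiA _) _ (hiA _)
              (init_lt_last hi))
          · have := h' j fun l => ⟨hAY (hjA l), (hj.monotone (Fin.le_last l)).trans_lt hlt⟩
            rwa [Fin.snoc_init_self] at this
        by_cases hlast : i (Fin.last n) = j (Fin.last n)
        · have h1 := (hgood _ (hAX (hiA (Fin.last n)))).iff_of_le (Fin.init i) (Fin.init j)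
            (hpre (fun l => hiA (Fin.castSucc l)) (init_lt_last hi))
            (hpre (fun l => hjA (Fin.castSucc l)) (hlast ▸ init_lt_last hj))
            w (mem_insert_self _ _) (hw _ (hAX (hiA _))).le
          have h2 := hv (Fin.init i) (Fin.init j) (strictMono_init hi) (strictMono_init hj)
            (fun l => hiA _) (fun l => hjA _)
          rw [Fin.snoc_init_self, hlast, Fin.snoc_init_self] at h1
          rw [h1, h2]
          simp [or_imp, forall_and, hlast, Fin.init]
        · refine iff_of_false ?_ fun h' => hlast (h' _ (by simp))
          rcases Nat.lt_or_gt_of_ne hlast with h' | h'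
          · exact (hne hj hi hjA hiA h').symm
          · exact hne hi hj hiA hjA h'
      -- Always constant: the last entry can be replaced by `w`.
      · refine ⟨v.map Fin.castSuccEmb, fun i j hi hj hiA hjA => ?_⟩
        have htop : ∀ {i : Fin (n + 1) → ℕ}, StrictMono i → (∀ l, i l ∈ A) →
            F i = F (Fin.snoc (Fin.init i) w) := by
          intro i hi hiA
          have hc := not_not.1 (h (Fin.init i) (strictMono_init hi) (fun l => hiA _) _ (hiA _)
            (init_lt_last hi))
          have := hc (i (Fin.last n)) (hAY (hiA _)) w (mem_insert_self _ _) le_rfl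
            (hw _ (hAX (hiA _))).le
          rwa [Fin.snoc_init_self] at this
        rw [htop hi hiA, htop hj hjA, hv (Fin.init i) (Fin.init j) (strictMono_init hi)
          (strictMono_init hj) (fun l => hiA _) (fun l => hjA _)]
        simp [Fin.init]
    · rcases hhom (some j) with h | h
      · refine Or.inr fun b hb hbA z hz hbz => ?_
        have hn := h (Fin.init b) (strictMono_init hb) (fun l => hbA _) _ (hbA _) (init_lt_last hb)
        rcases (hgood _ (hAX (hbA (Fin.last n)))).full_or_empty j (Fin.init b)
          (hpre (fun l => hbA (Fin.castSucc l)) (init_lt_last hb)) with h' | h'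
        · exact absurd h' hn
        · have := h' z (hAY hz) (hbz _)
          rwa [Fin.snoc_init_self] at this
      · refine Or.inl fun b hb hbA z hz hbz => ?_
        have hn := not_not.1 (h (Fin.init b) (strictMono_init hb) (fun l => hbA _) _ (hbA _)
          (init_lt_last hb))
        have := hn (b (Fin.last n)) (hAY (hbA _)) z (hAY hz) le_rfl (hbz _)
        rwa [Fin.snoc_init_self] at this

theorem exists_isCanonicalOn {β : Type u} {m N : ℕ} (hm : 0 < m) (n : ℕ)
    (hN : canonBound n 0 m ≤ N) (f : Finset ℕ → β) :
    ∃ A : Finset ℕ, A ⊆ Icc 1 N ∧ A.card = m ∧ IsCanonicalOn n f A := by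
  obtain ⟨A, hA, hAm, hv, -⟩ := exists_canonical hm n (ι := Empty)
    (fun i => f (univ.image i)) (fun j => j.elim) (fun j => j.elim) (Icc 1 N) (by simpa using hN)
  exact ⟨A, hA, hAm, hv⟩

end Canonization

/-! ### Estimates for the bounds. -/

section Growth

theorem finBeth_mono (k : ℕ) : Monotone (finBeth k) := by
  induction k with
  | zero => exact monotone_id
  | succ k ih => exact fun x y h => Nat.pow_le_pow_right (by norm_num) (ih h)

theorem le_finBeth (k x : ℕ) : x ≤ finBeth k x := by
  induction k with
  | zero => exact le_rfl
  | succ k ih => exact ih.trans Nat.lt_two_pow_self.le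

/-- Lets outer constants move into the innermost argument; it rests on `q ≤ 2 ^ (q - 1)`. -/
theorem mul_finBeth_le (k : ℕ) {q x : ℕ} (hq : 0 < q) (hx : 0 < x) :
    q * finBeth k x ≤ finBeth k (q * x) := by
  induction k with
  | zero => exact le_rfl
  | succ k ih =>
    have h0 : 0 < finBeth k x := hx.trans_le (le_finBeth k x)
    obtain ⟨r, rfl⟩ : ∃ r, q = r + 1 := ⟨q - 1, by omega⟩
    have h1 : r + 1 ≤ 2 ^ r := Nat.lt_two_pow_self
    calc (r + 1) * 2 ^ finBeth k x ≤ 2 ^ (r * finBeth k x) * 2 ^ finBeth k x := by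
          refine Nat.mul_le_mul_right _ (h1.trans (Nat.pow_le_pow_right (by norm_num) ?_))
          exact Nat.le_mul_of_pos_right _ h0
      _ = 2 ^ ((r + 1) * finBeth k x) := by rw [← pow_add, add_mul, one_mul]
      _ ≤ _ := Nat.pow_le_pow_right (by norm_num) ih

theorem treeBound_le (n s : ℕ) : ∃ C, 0 < C ∧ ∀ L, 0 < L →
    treeBound n s L ≤ 2 ^ (C * L ^ (2 * n + 1)) := by
  refine ⟨5 + (1000 * (s + 1) + 2 * n + 2) * (s + 2), by positivity, fun L hL => ?_⟩
  have hl : ∀ x : ℕ, x ≤ 2 ^ x := fun x => Nat.lt_two_pow_self.le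
  have h1 : 16 * L ≤ 2 ^ (5 * L) := by
    calc 16 * L ≤ 2 ^ 4 * 2 ^ L := Nat.mul_le_mul (by norm_num) (hl L)
      _ = 2 ^ (4 + L) := (pow_add _ _ _).symm
      _ ≤ _ := Nat.pow_le_pow_right (by norm_num) (by omega)
  have h2 : 1000 * (s + 1) * L ^ (2 * n + 2) ≤ 2 ^ ((1000 * (s + 1) + 2 * n + 2) * L) := by
    calc 1000 * (s + 1) * L ^ (2 * n + 2)
        ≤ 2 ^ (1000 * (s + 1)) * (2 ^ L) ^ (2 * n + 2) :=
          Nat.mul_le_mul (hl _) (Nat.pow_le_pow_left (hl L) _)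
      _ = 2 ^ (1000 * (s + 1) + L * (2 * n + 2)) := by rw [← pow_mul, ← pow_add]
      _ ≤ _ := Nat.pow_le_pow_right (by norm_num) (by nlinarith)
  have h3 : L ^ (2 * n) + (s + 1) * L ^ n ≤ (s + 2) * L ^ (2 * n) := by
    have : L ^ n ≤ L ^ (2 * n) := Nat.pow_le_pow_right hL (by omega)
    nlinarith
  calc treeBound n s L
      ≤ 2 ^ (5 * L) * (2 ^ ((1000 * (s + 1) + 2 * n + 2) * L)) ^ ((s + 2) * L ^ (2 * n)) := by
        refine Nat.mul_le_mul h1 ((Nat.pow_le_pow_left h2 _).trans ?_)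
        exact Nat.pow_le_pow_right (by positivity) h3
    _ = 2 ^ (5 * L + (1000 * (s + 1) + 2 * n + 2) * (s + 2) * L ^ (2 * n + 1)) := by
        rw [← pow_mul, ← pow_add]
        ring_nf
    _ ≤ _ := by
        refine Nat.pow_le_pow_right (by norm_num) ?_
        rw [add_mul 5]
        have : L ≤ L ^ (2 * n + 1) := Nat.le_self_pow (by omega) _
        omega

/-- At the lowest stage the number of tests, `s + 2`, does not depend on `L`; this saves one
exponential. -/
theorem canonBound_one (s m : ℕ) :
    canonBound 1 s m =
      (16 * 2 ^ (s + 1) * (1000 * (s + 1) * (2 ^ (s + 1)) ^ 2) ^ (s + 2)) * m ^ (2 * s + 5) := by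
  simp only [canonBound, treeBound, mul_zero, pow_zero, zero_add, mul_one, mul_pow]
  ring

/-- The exponent starts as `3 * (2 * (s + 1) + 5) = 6 * s + 21`; each further stage only raises `s`
by one, since powers taken outside an exponential become constant factors inside. -/
theorem canonBound_le_finBeth (k : ℕ) : ∀ s, ∃ C, 0 < C ∧ ∀ m, 0 < m →
    canonBound (k + 2) s m ≤ finBeth (k + 1) (C * m ^ (6 * (s + k) + 21)) := by
  induction k with
  | zero =>
    intro s
    obtain ⟨C, hC, h⟩ := treeBound_le 1 s
    refine ⟨C * (16 * 2 ^ (s + 1 + 1) *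
      (1000 * (s + 1 + 1) * (2 ^ (s + 1 + 1)) ^ 2) ^ (s + 1 + 2)) ^ 3, by positivity,
      fun m hm => (h _ (canonBound_pos hm 1 (s + 1))).trans (le_of_eq ?_)⟩
    rw [canonBound_one]
    simp only [finBeth]
    congr 1
    ring
  | succ k ih =>
    intro s
    obtain ⟨C, hC, h⟩ := treeBound_le (k + 2) s
    obtain ⟨D, hD, hD'⟩ := ih (s + 1)
    refine ⟨(C + (2 * (k + 2) + 1)) * D, by positivity, fun m hm => ?_⟩
    refine (h _ (canonBound_pos hm (k + 2) (s + 1))).trans ?_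
    refine Nat.pow_le_pow_right (by norm_num) ?_
    have he : 6 * (s + 1 + k) + 21 = 6 * (s + (k + 1)) + 21 := by ring
    have hD'' := hD' m hm
    rw [he] at hD''
    set x := D * m ^ (6 * (s + (k + 1)) + 21) with hx
    have hx0 : 0 < x := by positivity
    have h0 : 0 < finBeth k x := hx0.trans_le (le_finBeth k x)
    calc C * canonBound (k + 2) (s + 1) m ^ (2 * (k + 2) + 1)
        ≤ 2 ^ (C * finBeth k x) * (2 ^ finBeth k x) ^ (2 * (k + 2) + 1) := by
          refine Nat.mul_le_mul ?_ (Nat.pow_le_pow_left hD'' _)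
          exact Nat.lt_two_pow_self.le.trans (Nat.pow_le_pow_right (by norm_num)
            (Nat.le_mul_of_pos_right _ h0))
      _ = 2 ^ ((C + (2 * (k + 2) + 1)) * finBeth k x) := by
          rw [← pow_mul, ← pow_add]
          ring_nf
      _ ≤ 2 ^ finBeth k ((C + (2 * (k + 2) + 1)) * x) :=
          Nat.pow_le_pow_right (by norm_num) (mul_finBeth_le k (by positivity) hx0)
      _ = _ := by rw [hx, mul_assoc]; rfl

theorem canonBound_eventually_le {n : ℕ} (hn : 1 ≤ n) : ∃ M, 0 < M ∧ ∀ m, M ≤ m →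
    canonBound n 0 m ≤ finBeth (n - 1) (m ^ (8 * (2 * n - 1))) := by
  have absorb : ∀ C m e e', 0 < C → C ≤ m → e + 1 ≤ e' → C * m ^ e ≤ m ^ e' := by
    intro C m e e' hC hm he
    calc C * m ^ e ≤ m * m ^ e := Nat.mul_le_mul_right _ hm
      _ = m ^ (e + 1) := (pow_succ' _ _).symm
      _ ≤ _ := Nat.pow_le_pow_right (by omega) he
  obtain rfl | ⟨k, rfl⟩ : n = 1 ∨ ∃ k, n = k + 2 := by
    rcases Nat.lt_or_ge n 2 with h | h
    · exact Or.inl (by omega)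
    · exact Or.inr ⟨n - 2, by omega⟩
  · refine ⟨16 * 2 ^ (0 + 1) * (1000 * (0 + 1) * (2 ^ (0 + 1)) ^ 2) ^ (0 + 2), by positivity,
      fun m hm => ?_⟩
    rw [canonBound_one]
    exact absorb _ _ _ _ (by positivity) hm (by norm_num)
  · obtain ⟨C, hC, h⟩ := canonBound_le_finBeth k 0
    refine ⟨C, hC, fun m hm => (h m (by omega)).trans (finBeth_mono _ ?_)⟩
    -- One extra power of `m` swallows the constant: `6 * k + 22 ≤ 8 * (2 * (k + 2) - 1)`.
    exact absorb _ _ _ _ hC hm (by omega)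

end Growth

/-! ### Polynomial bound for all `m`. -/

section UpperBound

theorem Canonizes.anti {N n m m' : ℕ} (h : Canonizes.{u} N n m) (hm : m' ≤ m) :
    Canonizes.{u} N n m' := by
  intro β f
  obtain ⟨A, hA, rfl, v, hv⟩ := h β f
  obtain ⟨A', hA', rfl⟩ := exists_subset_card_eq hm
  exact ⟨A', hA'.trans hA, rfl, v, fun i j hi hj hiA hjA =>
    hv i j hi hj (fun l => hA' (hiA l)) fun l => hA' (hjA l)⟩

theorem ER_le {N n m : ℕ} (h : Canonizes.{u} N n m) : ER.{u} n m ≤ N := sInf_le ⟨N, rfl, h⟩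

theorem exists_polynomial_ER_le {n : ℕ} (hn : 1 ≤ n) : ∃ p : Polynomial ℕ, ∀ m : ℕ,
    ER.{u} n m ≤ (finBeth (n - 1) (p.eval m) : ℕ∞) := by
  obtain ⟨M, hM, h⟩ := canonBound_eventually_le hn
  -- The constant term takes care of `m < M`, where a canonical set of size `M` is cut down.
  refine ⟨Polynomial.X ^ (8 * (2 * n - 1)) + Polynomial.C (M ^ (8 * (2 * n - 1))), fun m => ?_⟩
  have hcan : ∀ m', M ≤ m' → Canonizes.{u} (finBeth (n - 1) (m' ^ (8 * (2 * n - 1)))) n m' :=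
    fun m' hm' β f => exists_isCanonicalOn (by omega) n (h m' hm') f
  have hER : ∀ x, Canonizes.{u} (finBeth (n - 1) x) n m →
      x ≤ m ^ (8 * (2 * n - 1)) + M ^ (8 * (2 * n - 1)) →
      ER.{u} n m ≤ (finBeth (n - 1) (m ^ (8 * (2 * n - 1)) + M ^ (8 * (2 * n - 1))) : ℕ∞) :=
    fun x hx hle => (ER_le hx).trans (by exact_mod_cast finBeth_mono _ hle)
  simp only [Polynomial.eval_add, Polynomial.eval_pow, Polynomial.eval_X, Polynomial.eval_C]
  rcases le_total M m with hm | hm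
  · exact hER _ (hcan m hm) (Nat.le_add_right _ _)
  · exact hER _ ((hcan M le_rfl).anti hm) (Nat.le_add_left _ _)

end UpperBound

/-! ### Most significant differing digits. -/

section SepLevel

/-- The position of the most significant digit in base `q` at which `x` and `y` differ. -/
noncomputable def sepLevel (q x y : ℕ) : ℕ := sInf {k | x / q ^ (k + 1) = y / q ^ (k + 1)}

theorem sepLevel_le_iff {q : ℕ} (hq : 1 < q) {x y k : ℕ} :
    sepLevel q x y ≤ k ↔ x / q ^ (k + 1) = y / q ^ (k + 1) := by
  refine ⟨fun h => ?_, fun h => Nat.sInf_le h⟩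
  have hne : {k | x / q ^ (k + 1) = y / q ^ (k + 1)}.Nonempty := by
    refine ⟨x + y, ?_⟩
    have h1 : x + y + 1 < q ^ (x + y + 1) := Nat.lt_pow_self hq
    simp only [Set.mem_ofPred_eq]
    rw [Nat.div_eq_of_lt (by omega), Nat.div_eq_of_lt (by omega)]
  have h1 : x / q ^ (sepLevel q x y + 1) = y / q ^ (sepLevel q x y + 1) := Nat.sInf_mem hne
  have h2 : q ^ (k + 1) = q ^ (sepLevel q x y + 1) * q ^ (k - sepLevel q x y) := by
    rw [← pow_add]; congr 1; omega
  rw [h2, ← Nat.div_div_eq_div_mul, ← Nat.div_div_eq_div_mul, h1]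

theorem div_pow_sepLevel_ne {q : ℕ} (hq : 1 < q) {x y : ℕ} (h : x ≠ y) :
    x / q ^ sepLevel q x y ≠ y / q ^ sepLevel q x y := by
  intro h'
  rcases hk : sepLevel q x y with _ | k
  · rw [hk] at h'; simp at h'; exact h h'
  · rw [hk] at h'
    have := (sepLevel_le_iff hq).2 h'
    omega

theorem sepLevel_lt {q N x y : ℕ} (hq : 1 < q) (h : x ≠ y) (hx : x < q ^ N) (hy : y < q ^ N) :
    sepLevel q x y < N := by
  obtain ⟨M, rfl⟩ : ∃ M, N = M + 1 := by
    rcases N with _ | M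
    · simp at hx hy; omega
    · exact ⟨M, rfl⟩
  exact Nat.lt_succ_of_le ((sepLevel_le_iff hq).2
    (by rw [Nat.div_eq_of_lt hx, Nat.div_eq_of_lt hy]))

theorem sepLevel_eq_max {q x y z : ℕ} (hq : 1 < q) (hxy : x ≤ y) (hyz : y ≤ z) :
    sepLevel q x z = max (sepLevel q x y) (sepLevel q y z) := by
  refine eq_of_forall_ge_iff fun k => ?_
  rw [max_le_iff, sepLevel_le_iff hq, sepLevel_le_iff hq, sepLevel_le_iff hq]
  have h1 : x / q ^ (k + 1) ≤ y / q ^ (k + 1) := Nat.div_le_div_right hxy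
  have h2 : y / q ^ (k + 1) ≤ z / q ^ (k + 1) := Nat.div_le_div_right hyz
  omega

/-- Equal levels would require three increasing binary digits at one position. -/
theorem sepLevel_two_ne {x y z : ℕ} (hxy : x < y) (hyz : y < z) :
    sepLevel 2 x y ≠ sepLevel 2 y z := by
  intro h
  have h1 := div_pow_sepLevel_ne one_lt_two hxy.ne
  have h2 := div_pow_sepLevel_ne one_lt_two hyz.ne
  have h3 := (sepLevel_le_iff one_lt_two).1 (le_refl (sepLevel 2 x y))
  have h4 := (sepLevel_le_iff one_lt_two).1 (le_refl (sepLevel 2 y z))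
  rw [← h] at h2 h4
  rw [pow_succ, ← Nat.div_div_eq_div_mul, ← Nat.div_div_eq_div_mul] at h3 h4
  have h5 : x / 2 ^ sepLevel 2 x y ≤ y / 2 ^ sepLevel 2 x y := Nat.div_le_div_right hxy.le
  have h6 : y / 2 ^ sepLevel 2 x y ≤ z / 2 ^ sepLevel 2 x y := Nat.div_le_div_right hyz.le
  omega

end SepLevel

/-! ### Stepping up colorings without large monochromatic sets. -/

section Coloring

/-- All increasing tuples with entries in `A` get the same color. -/
def IsMonochromatic {C : Type*} {n : ℕ} (χ : (Fin n → ℕ) → C) (A : Finset ℕ) : Prop :=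
  ∀ i j, StrictMono i → StrictMono j → (∀ l, i l ∈ A) → (∀ l, j l ∈ A) → χ i = χ j

theorem exists_pair_coloring (d : ℕ) {m : ℕ} (hm : 0 < m) :
    ∃ χ : (Fin 2 → ℕ) → Fin (d + 1),
      ∀ A ⊆ range (m ^ d), IsMonochromatic χ A → A.card ≤ m := by
  -- A monochromatic set has pairwise distinct base-`m` digits at one position. The cap `d` is never
  -- reached by distinct numbers below `m ^ d`.
  refine ⟨fun i => ⟨min (sepLevel m (i 0) (i 1)) d, by omega⟩, fun A hA hmono => ?_⟩
  by_cases hA1 : A.card ≤ 1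
  · omega
  obtain ⟨x, hx, y, hy, hxy⟩ : ∃ x ∈ A, ∃ y ∈ A, x < y := by
    obtain ⟨x, hx, y, hy, hne⟩ := one_lt_card.1 (not_le.1 hA1)
    rcases Nat.lt_or_gt_of_ne hne with h | h
    exacts [⟨x, hx, y, hy, h⟩, ⟨y, hy, x, hx, h⟩]
  have hlt : ∀ {x}, x ∈ A → x < m ^ d := fun hx => mem_range.1 (hA hx)
  have hm1 : 1 < m := by
    rcases Nat.lt_or_ge 1 m with h | h
    · exact h
    · have hm' : m = 1 := by omega
      have := hlt hy
      rw [hm', one_pow] at this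
      omega
  have hpair : ∀ {a b : ℕ}, a < b → StrictMono ![a, b] := fun h => by
    simpa [Fin.strictMono_iff_lt_succ] using h
  have hlevel : ∀ a ∈ A, ∀ b ∈ A, a < b → sepLevel m a b = sepLevel m x y := by
    intro a ha b hb hab
    have h := hmono ![a, b] ![x, y] (hpair hab) (hpair hxy) (by simp [Fin.forall_fin_two, ha, hb])
      (by simp [Fin.forall_fin_two, hx, hy])
    have h1 := sepLevel_lt hm1 hab.ne (hlt ha) (hlt hb)
    have h2 := sepLevel_lt hm1 hxy.ne (hlt hx) (hlt hy)
    simp only [Fin.mk.injEq, Matrix.cons_val_zero, Matrix.cons_val_one] at h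
    omega
  have hne : ∀ a ∈ A, ∀ b ∈ A, a < b →
      a / m ^ sepLevel m x y % m ≠ b / m ^ sepLevel m x y % m := by
    intro a ha b hb hab h
    have h1 := div_pow_sepLevel_ne hm1 hab.ne
    have h2 := (sepLevel_le_iff hm1).1 (le_refl (sepLevel m a b))
    rw [hlevel a ha b hb hab] at h1 h2
    rw [pow_succ, ← Nat.div_div_eq_div_mul, ← Nat.div_div_eq_div_mul] at h2
    apply h1
    rw [← Nat.div_add_mod (a / m ^ sepLevel m x y) m, ← Nat.div_add_mod (b / m ^ sepLevel m x y) m,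
      h, h2]
  rw [← card_range m]
  refine card_le_card_of_injOn (fun a => a / m ^ sepLevel m x y % m)
    (fun a _ => by simpa using Nat.mod_lt _ hm) fun a ha b hb h => ?_
  by_contra hab
  rcases Nat.lt_or_gt_of_ne hab with h' | h'
  · exact hne a ha b hb h' h
  · exact hne b hb a ha h' h.symm

theorem strictMono_cons {k x : ℕ} {T : Fin k → ℕ} (hT : StrictMono T) (h : ∀ l, x < T l) :
    StrictMono (Fin.cons x T : Fin (k + 1) → ℕ) := by
  intro i j hij
  induction j using Fin.cases with
  | zero => exact absurd hij (Fin.not_lt_zero i)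
  | succ j =>
    induction i using Fin.cases with
    | zero => simpa using h j
    | succ i => simpa using hT (Fin.succ_lt_succ_iff.1 hij)

theorem strictMono_snoc {k x : ℕ} {T : Fin k → ℕ} (hT : StrictMono T) (h : ∀ l, T l < x) :
    StrictMono (Fin.snoc T x : Fin (k + 1) → ℕ) := by
  intro i j hij
  induction i using Fin.lastCases with
  | last => exact absurd hij (not_lt.2 (Fin.le_last j))
  | cast i =>
    induction j using Fin.lastCases with
    | last => simpa using h i
    | cast j => simpa using hT (Fin.castSucc_lt_castSucc_iff.1 hij)

/-- The tuple `T` pads triples to full length, so that the color of a padded triple shows how its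
two levels compare. -/
theorem exists_top_tuple (k : ℕ) (A : Finset ℕ) (hk : k ≤ A.card) :
    ∃ A₀ ⊆ A, A₀.card + k = A.card ∧ ∃ T : Fin k → ℕ, StrictMono T ∧ (∀ l, T l ∈ A) ∧
      ∀ x ∈ A₀, ∀ l, x < T l := by
  induction k with
  | zero => exact ⟨A, subset_rfl, rfl, Fin.elim0, fun i => i.elim0, fun i => i.elim0,
      fun _ _ i => i.elim0⟩
  | succ k ih =>
    obtain ⟨A₀, hA₀, hc, T, hT, hTA, hlt⟩ := ih (by omega)
    have hne : A₀.Nonempty := card_pos.1 (by omega)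
    have hmax := A₀.max'_mem hne
    refine ⟨A₀.erase (A₀.max' hne), (erase_subset _ _).trans hA₀, ?_,
      Fin.cons (A₀.max' hne) T, strictMono_cons hT fun l => hlt _ hmax l, ?_, ?_⟩
    · rw [card_erase_of_mem hmax]; omega
    · exact Fin.cases (by simpa using hA₀ hmax) (by simpa using hTA)
    · intro x hx
      have hx' := mem_of_mem_erase hx
      exact Fin.cases (by simpa using A₀.lt_max'_of_mem_erase_max' hne hx) (by simpa using hlt x hx')

/-- The separation levels of consecutive entries. -/
noncomputable def levels {n : ℕ} (t : Fin (n + 1) → ℕ) (l : Fin n) : ℕ :=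
  sepLevel 2 (t l.castSucc) (t l.succ)

/-- The first color component makes consecutive levels always increase or always decrease on `A₀`.
Either way, the levels relative to one extreme point form a `χ`-monochromatic set of size `|A₀| -
1`. The loss `k + 1` is the padding plus that point. -/
theorem exists_stepUp_coloring {C : Type*} {k N m : ℕ} (χ : (Fin (k + 2) → ℕ) → C)
    (hχ : ∀ A ⊆ range N, IsMonochromatic χ A → A.card ≤ m) :
    ∃ χ' : (Fin (k + 3) → ℕ) → Bool × C × C,
      ∀ A ⊆ range (2 ^ N), IsMonochromatic χ' A → A.card ≤ m + (k + 1) := by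
  refine ⟨fun t => (decide (sepLevel 2 (t 0) (t 1) < sepLevel 2 (t 1) (t 2)), χ (levels t),
    χ (levels t ∘ Fin.rev)), fun A hA hmono => ?_⟩
  by_contra! hcard
  obtain ⟨A₀, hA₀, hc, T, hT, hTA, hlt⟩ := exists_top_tuple k A (by omega)
  have hne : A₀.Nonempty := card_pos.1 (by omega)
  have hlevel : ∀ x ∈ A₀, ∀ y ∈ A₀, x ≠ y → sepLevel 2 x y ∈ range N := fun x hx y hy hxy =>
    mem_range.2 (sepLevel_lt one_lt_two hxy (mem_range.1 (hA (hA₀ hx))) (mem_range.1 (hA (hA₀ hy))))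
  by_cases hinc : ∃ x ∈ A₀, ∃ y ∈ A₀, ∃ z ∈ A₀, x < y ∧ y < z ∧ sepLevel 2 x y < sepLevel 2 y z
  · have hall : ∀ x ∈ A₀, ∀ y ∈ A₀, ∀ z ∈ A₀, x < y → y < z →
        sepLevel 2 x y < sepLevel 2 y z := by
      obtain ⟨x', hx', y', hy', z', hz', hxy', hyz', h'⟩ := hinc
      intro x hx y hy z hz hxy hyz
      have hmonoT : ∀ {x y z}, x ∈ A₀ → y ∈ A₀ → z ∈ A₀ → x < y → y < z →
          StrictMono (Fin.cons x (Fin.cons y (Fin.cons z T)) : Fin (k + 3) → ℕ) := by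
        intro x y z hx hy hz hxy hyz
        refine strictMono_cons (strictMono_cons (strictMono_cons hT (hlt z hz)) ?_) ?_
        · exact Fin.cases (by simpa using hyz) (by simpa using hlt y hy)
        · exact Fin.cases (by simpa using hxy)
            (Fin.cases (by simpa using hxy.trans hyz) (by simpa using hlt x hx))
      have hmemT : ∀ {x y z}, x ∈ A₀ → y ∈ A₀ → z ∈ A₀ →
          ∀ l, (Fin.cons x (Fin.cons y (Fin.cons z T)) : Fin (k + 3) → ℕ) l ∈ A := by
        intro x y z hx hy hz
        exact Fin.cases (hA₀ hx) (Fin.cases (hA₀ hy) (Fin.cases (hA₀ hz) hTA))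
      have h := hmono _ _ (hmonoT hx hy hz hxy hyz) (hmonoT hx' hy' hz' hxy' hyz')
        (hmemT hx hy hz) (hmemT hx' hy' hz')
      have h1 := (Prod.ext_iff.1 h).1
      have e1 : (1 : Fin (k + 3)) = Fin.succ 0 := rfl
      have e2 : (2 : Fin (k + 3)) = Fin.succ (Fin.succ 0) := rfl
      simp only [e1, e2, Fin.cons_zero, Fin.cons_succ, decide_eq_decide] at h1
      exact h1.2 h'
    -- With increasing levels, the level of `y < z` equals that of `x₀, z`, so a tuple of levels
    -- lifts by prepending `x₀`.
    set x₀ := A₀.min' hne with hx₀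
    have hx₀A : x₀ ∈ A₀ := A₀.min'_mem hne
    have hx₀lt : ∀ y ∈ A₀.erase x₀, x₀ < y := fun y hy => A₀.min'_lt_of_mem_erase_min' hne hy
    have hsucc : ∀ y ∈ A₀.erase x₀, ∀ z ∈ A₀.erase x₀, y < z →
        sepLevel 2 y z = sepLevel 2 x₀ z ∧ sepLevel 2 x₀ y < sepLevel 2 x₀ z := by
      intro y hy z hz hyz
      have h1 := hall x₀ hx₀A y (mem_of_mem_erase hy) z (mem_of_mem_erase hz) (hx₀lt y hy) hyz
      have h2 := sepLevel_eq_max one_lt_two (hx₀lt y hy).le hyz.le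
      omega
    have hinj : Set.InjOn (sepLevel 2 x₀) (A₀.erase x₀ : Finset ℕ) := by
      intro y hy z hz h
      by_contra hyz
      rcases Nat.lt_or_gt_of_ne hyz with h' | h'
      · have := (hsucc y hy z hz h').2; omega
      · have := (hsucc z hz y hy h').2; omega
    have hlift : ∀ t : Fin (k + 2) → ℕ, StrictMono t →
        (∀ l, t l ∈ (A₀.erase x₀).image (sepLevel 2 x₀)) →
        ∃ t' : Fin (k + 3) → ℕ, StrictMono t' ∧ (∀ l, t' l ∈ A) ∧ levels t' = t := by
      intro t ht htA
      choose y hy hyt using fun l => mem_image.1 (htA l)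
      have hymono : StrictMono y := by
        intro i j hij
        by_contra! h
        have h1 := ht hij
        rw [← hyt i, ← hyt j] at h1
        rcases h.eq_or_lt with h' | h'
        · rw [h'] at h1; omega
        · have := (hsucc _ (hy j) _ (hy i) h').2; omega
      refine ⟨Fin.cons x₀ y, strictMono_cons hymono fun l => hx₀lt _ (hy l),
        Fin.cases (by simpa using hA₀ hx₀A)
          (fun l => by simpa using hA₀ (mem_of_mem_erase (hy l))), funext fun l => ?_⟩
      rw [← hyt l]
      induction l using Fin.cases with
      | zero => simp [levels]
      | succ l =>
        simp only [levels, ← Fin.succ_castSucc, Fin.cons_succ]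
        exact (hsucc _ (hy _) _ (hy _) (hymono (Fin.castSucc_lt_succ (i := l)))).1
    have := hχ ((A₀.erase x₀).image (sepLevel 2 x₀)) ?_ ?_
    · rw [card_image_of_injOn hinj, card_erase_of_mem hx₀A] at this
      omega
    · intro e he
      obtain ⟨y, hy, rfl⟩ := mem_image.1 he
      exact hlevel _ hx₀A _ (mem_of_mem_erase hy) (hx₀lt y hy).ne
    · intro i j hi hj hiA hjA
      obtain ⟨i', hi', hi'A, rfl⟩ := hlift i hi hiA
      obtain ⟨j', hj', hj'A, rfl⟩ := hlift j hj hjA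
      exact (Prod.ext_iff.1 (Prod.ext_iff.1 (hmono i' j' hi' hj' hi'A hj'A)).2).1
  · have hall : ∀ x ∈ A₀, ∀ y ∈ A₀, ∀ z ∈ A₀, x < y → y < z →
        sepLevel 2 y z < sepLevel 2 x y := by
      intro x hx y hy z hz hxy hyz
      have h1 : ¬ sepLevel 2 x y < sepLevel 2 y z := fun h =>
        hinc ⟨x, hx, y, hy, z, hz, hxy, hyz, h⟩
      have h2 := sepLevel_two_ne hxy hyz
      omega
    -- Mirror image: decreasing levels are read off from the largest point, in reverse order.
    set x₁ := A₀.max' hne with hx₁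
    have hx₁A : x₁ ∈ A₀ := A₀.max'_mem hne
    have hx₁lt : ∀ y ∈ A₀.erase x₁, y < x₁ := fun y hy => A₀.lt_max'_of_mem_erase_max' hne hy
    have hsucc : ∀ y ∈ A₀.erase x₁, ∀ z ∈ A₀.erase x₁, y < z →
        sepLevel 2 y z = sepLevel 2 y x₁ ∧ sepLevel 2 z x₁ < sepLevel 2 y x₁ := by
      intro y hy z hz hyz
      have h1 := hall y (mem_of_mem_erase hy) z (mem_of_mem_erase hz) x₁ hx₁A hyz (hx₁lt z hz)
      have h2 := sepLevel_eq_max one_lt_two hyz.le (hx₁lt z hz).le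
      omega
    have hinj : Set.InjOn (sepLevel 2 · x₁) (A₀.erase x₁ : Finset ℕ) := by
      intro y hy z hz h
      simp only at h
      by_contra hyz
      rcases Nat.lt_or_gt_of_ne hyz with h' | h'
      · have := (hsucc y hy z hz h').2; omega
      · have := (hsucc z hz y hy h').2; omega
    have hlift : ∀ t : Fin (k + 2) → ℕ, StrictMono t →
        (∀ l, t l ∈ (A₀.erase x₁).image (sepLevel 2 · x₁)) →
        ∃ t' : Fin (k + 3) → ℕ, StrictMono t' ∧ (∀ l, t' l ∈ A) ∧ levels t' ∘ Fin.rev = t := by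
      intro t ht htA
      choose y hy hyt using fun l => mem_image.1 (htA l)
      have hyanti : ∀ {i j}, i < j → y j < y i := by
        intro i j hij
        by_contra! h
        have h1 := ht hij
        rw [← hyt i, ← hyt j] at h1
        rcases h.eq_or_lt with h' | h'
        · rw [h'] at h1; omega
        · have := (hsucc _ (hy i) _ (hy j) h').2; omega
      refine ⟨Fin.snoc (fun l => y (Fin.rev l)) x₁,
        strictMono_snoc (fun i j hij => hyanti (Fin.rev_lt_rev.2 hij)) fun l => hx₁lt _ (hy _),
        Fin.lastCases (by simpa using hA₀ hx₁A)
          (fun l => by simpa using hA₀ (mem_of_mem_erase (hy _))), ?_⟩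
      have : ∀ l, levels (Fin.snoc (fun l => y (Fin.rev l)) x₁ : Fin (k + 3) → ℕ) l =
          t (Fin.rev l) := by
        intro l
        rw [← hyt]
        induction l using Fin.lastCases with
        | last => simp [levels]
        | cast l =>
          simp only [levels, Fin.succ_castSucc, Fin.snoc_castSucc]
          exact (hsucc _ (hy _) _ (hy _)
            (hyanti (Fin.rev_lt_rev.2 (Fin.castSucc_lt_succ (i := l))))).1
      exact funext fun l => by simp [this]
    have := hχ ((A₀.erase x₁).image (sepLevel 2 · x₁)) ?_ ?_
    · rw [card_image_of_injOn hinj, card_erase_of_mem hx₁A] at this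
      omega
    · intro e he
      obtain ⟨y, hy, rfl⟩ := mem_image.1 he
      exact hlevel _ (mem_of_mem_erase hy) _ hx₁A (hx₁lt y hy).ne
    · intro i j hi hj hiA hjA
      obtain ⟨i', hi', hi'A, rfl⟩ := hlift i hi hiA
      obtain ⟨j', hj', hj'A, rfl⟩ := hlift j hj hjA
      exact (Prod.ext_iff.1 (Prod.ext_iff.1 (hmono i' j' hi' hj' hi'A hj'A)).2).2

/-- `C` and `r` are chosen before `m`, so that `m` can later exceed the number of colors. -/
theorem exists_coloring (d k : ℕ) : ∃ (C : Type) (_ : Fintype C) (r : ℕ), ∀ m, 0 < m →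
    ∃ χ : (Fin (k + 2) → ℕ) → C,
      ∀ A ⊆ range (finBeth k (m ^ d)), IsMonochromatic χ A → A.card ≤ m + r := by
  induction k with
  | zero => exact ⟨Fin (d + 1), inferInstance, 0, fun m hm => exists_pair_coloring d hm⟩
  | succ k ih =>
    obtain ⟨C, _, r, h⟩ := ih
    refine ⟨Bool × C × C, inferInstance, r + (k + 1), fun m hm => ?_⟩
    obtain ⟨χ, hχ⟩ := h m hm
    rw [← add_assoc]
    exact exists_stepUp_coloring χ hχ

end Coloring

/-! ### From colorings to lower bounds for `ER`. -/

section LowerBound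

theorem not_canonizes {C : Type} [Fintype C] {n N b m : ℕ} (χ : (Fin n → ℕ) → C)
    (hχ : ∀ A ⊆ range N, IsMonochromatic χ A → A.card ≤ b) (hb : b < m)
    (hC : Fintype.card C + n ≤ m) : ¬ Canonizes.{u} N n m := by
  intro hcan
  classical
  -- Subtracting 1 moves `{1, …, N}` to `range N`; the value at sets of other sizes is irrelevant.
  let f : Finset ℕ → ULift.{u} C := fun s =>
    if h : s.card = n then ⟨χ fun l => s.orderEmbOfFin h l - 1⟩ else ⟨χ 0⟩
  have hf : ∀ i : Fin n → ℕ, StrictMono i → f (univ.image i) = ⟨χ fun l => i l - 1⟩ := by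
    intro i hi
    have hcard : (univ.image i).card = n := by simp [card_image_of_injective _ hi.injective]
    have : i = (univ.image i).orderEmbOfFin hcard :=
      orderEmbOfFin_unique hcard (fun l => mem_image_of_mem _ (mem_univ l)) hi
    simp only [f, dif_pos hcard]
    rw [← this]
  obtain ⟨A, hA, hAm, v, hv⟩ := hcan _ f
  have hv' : ∀ i j : Fin n → ℕ, StrictMono i → StrictMono j → (∀ l, i l ∈ A) → (∀ l, j l ∈ A) →
      ((χ fun l => i l - 1) = (χ fun l => j l - 1) ↔ ∀ l ∈ v, i l = j l) := by
    intro i j hi hj hiA hjA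
    rw [← hv i j hi hj hiA hjA, hf i hi, hf j hj, ULift.up_inj]
  have hA1 : ∀ {x}, x ∈ A → 1 ≤ x ∧ x ≤ N := fun hx => mem_Icc.1 (hA hx)
  rcases v.eq_empty_or_nonempty with rfl | ⟨l, hl⟩
  · have hshift : ∀ {x}, x ∈ A.image (· - 1) → x + 1 ∈ A := by
      intro x hx
      obtain ⟨y, hy, rfl⟩ := mem_image.1 hx
      have := hA1 hy
      rwa [Nat.sub_add_cancel this.1]
    have := hχ (A.image (· - 1)) ?_ ?_
    · rw [card_image_of_injOn, hAm] at this
      · omega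
      · intro x hx y hy h
        have h1 := hA1 hx
        have h2 := hA1 hy
        simp only at h
        omega
    · intro x hx
      have := hA1 (hshift hx)
      exact mem_range.2 (by omega)
    · intro i j hi hj hiA hjA
      have := hv' (fun l => i l + 1) (fun l => j l + 1) (fun _ _ h => Nat.succ_lt_succ (hi h))
        (fun _ _ h => Nat.succ_lt_succ (hj h)) (fun l => hshift (hiA l)) fun l => hshift (hjA l)
      simpa using this
  · let e := A.orderEmbOfFin hAm
    -- Sliding windows in `A`: any two differ in every position, yet two share a color, so no
    -- position can lie in `v`.
    let t : Fin (Fintype.card C + 1) → Fin n → ℕ := fun x l => e ⟨x + l, by omega⟩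
    have ht : ∀ x, StrictMono (t x) := fun x i j hij =>
      e.strictMono (Fin.mk_lt_mk.2 (Nat.add_lt_add_left hij _))
    have htA : ∀ x l, t x l ∈ A := fun x l => orderEmbOfFin_mem _ _ _
    obtain ⟨x, y, hxy, h⟩ := Fintype.exists_ne_map_eq_of_card_lt
      (fun x => χ fun l => t x l - 1) (by simp)
    have := e.injective ((hv' _ _ (ht x) (ht y) (htA x) (htA y)).1 h l hl)
    rw [Fin.mk.injEq] at this
    exact hxy (Fin.ext (by omega))

theorem polynomial_eval_eventually_le (p : Polynomial ℕ) (r : ℕ) :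
    ∃ M, ∀ m, M ≤ m → p.eval m ≤ (m - r) ^ (p.natDegree + 1) := by
  refine ⟨2 * r + p.eval 1 * 2 ^ p.natDegree + 1, fun m hm => ?_⟩
  have h1 : p.eval m ≤ p.eval 1 * m ^ p.natDegree := by
    rw [Polynomial.eval_eq_sum_range, Polynomial.eval_eq_sum_range, sum_mul]
    refine sum_le_sum fun i hi => ?_
    rw [one_pow, mul_one]
    exact Nat.mul_le_mul_left _ (Nat.pow_le_pow_right (by omega)
      (Nat.lt_succ_iff.1 (mem_range.1 hi)))
  calc p.eval m ≤ p.eval 1 * (2 * (m - r)) ^ p.natDegree :=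
        h1.trans (Nat.mul_le_mul_left _ (Nat.pow_le_pow_left (by omega) _))
    _ = (p.eval 1 * 2 ^ p.natDegree) * (m - r) ^ p.natDegree := by rw [mul_pow, mul_assoc]
    _ ≤ (m - r) * (m - r) ^ p.natDegree := Nat.mul_le_mul_right _ (by omega)
    _ = _ := (pow_succ' _ _).symm

theorem eventually_finBeth_lt_ER {n : ℕ} (hn : 2 ≤ n) (p : Polynomial ℕ) : ∃ M, ∀ m, M ≤ m →
    (finBeth (n - 2) (p.eval m) : ℕ∞) < ER.{u} n m := by
  obtain ⟨k, rfl⟩ : ∃ k, n = k + 2 := ⟨n - 2, by omega⟩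
  obtain ⟨C, _, r, h⟩ := exists_coloring (p.natDegree + 1) k
  obtain ⟨M, hM⟩ := polynomial_eval_eventually_le p (r + 1)
  refine ⟨M + (r + 2) + (Fintype.card C + (k + 2)), fun m hm => ?_⟩
  -- Monochromatic sets then have at most `m - (r + 1) + r = m - 1` elements.
  obtain ⟨χ, hχ⟩ := h (m - (r + 1)) (by omega)
  rw [Nat.add_sub_cancel]
  refine lt_of_lt_of_le (b := ((finBeth k (p.eval m) + 1 : ℕ) : ℕ∞))
    (by exact_mod_cast Nat.lt_succ_self _) (le_sInf ?_)
  rintro _ ⟨N, rfl, hN⟩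
  have : finBeth k (p.eval m) < N := by
    by_contra! hle
    have hle' := hle.trans (finBeth_mono k (hM m (by omega)))
    exact not_canonizes χ (fun A hA => hχ A (hA.trans (range_subset_range.2 hle'))) (by omega)
      (by omega) hN
  exact_mod_cast this

end LowerBound

theorem lemma1p1 :
    (∃ c : ℕ → ℕ, Computable c ∧ ∀ n : ℕ, 1 ≤ n → ∃ M : ℕ, ∀ m : ℕ, M ≤ m →
      ∀ N : ℕ, finBeth (n - 1) (c n * m ^ (8 * (2 * n - 1))) < N →
        ∀ (β : Type u) (f : Finset ℕ → β),
          ∃ A : Finset ℕ, A ⊆ Finset.Icc 1 N ∧ A.card = m ∧ IsCanonicalOn n f A) ∧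
    (∀ n : ℕ, 1 ≤ n → ∃ p : Polynomial ℕ, ∀ m : ℕ,
      ER.{u} n m ≤ (finBeth (n - 1) (p.eval m) : ℕ∞)) ∧
    (∀ n : ℕ, 2 ≤ n → ∀ p : Polynomial ℕ, ∃ M : ℕ, ∀ m : ℕ, M ≤ m →
      (finBeth (n - 2) (p.eval m) : ℕ∞) < ER.{u} n m) := by
  -- `c_n = 1` works, because the spare exponent absorbs all constants for large `m`.
  refine ⟨⟨fun _ => 1, Computable.const 1, fun n hn => ?_⟩,
    fun n hn => exists_polynomial_ER_le hn, fun n hn p => eventually_finBeth_lt_ER hn p⟩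
  obtain ⟨M, hM, h⟩ := canonBound_eventually_le hn
  refine ⟨M, fun m hm N hN β f => exists_isCanonicalOn (by omega) n ((h m hm).trans ?_) f⟩
  rw [one_mul] at hN
  exact hN.le
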